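/- Let $G$ be a Polish group. A $G$-flow is a compact Hausdorff space with a continuous left action of $G$; it is minimal if it is nonempty and every orbit is dense, and proximal if for all points $x,y$ there is a net $(g_\lambda)$ in $G$ with $\lim_\lambda g_\lambda x=\lim_\lambda g_\lambda y$. Let $\Pi(G)$ be the universal minimal proximal flow of $G$, that is, the (up to isomorphism unique) minimal proximal $G$-flow that maps by a continuous $G$-equivariant surjection onto every minimal proximal $G$-flow. An affine $G$-flow is a nonempty compact convex subset $K$ of a Hausdorff locally convex real topological vector space together with a continuous action of $G$ on $K$ by affine homeomorphisms; an affine subflow is a nonempty $G$-invariant compact convex subset; an affine extension $\phi\colon L\to K$ of affine $G$-flows is a continuous, affine, $G$-equivariant surjection. An affine extension $\phi\colon L\to K$ is proximally irreducible if the only affine subflow $C\subseteq L$ such that $$C\cap \operatorname{conv}\bigl(\overline{\operatorname{ext}}(L)\cap\phi^{-1}(\{y\})\bigr)\neq\emptyset\quad\text{for all } y\in\overline{\operatorname{ext}}(K)$$ is $C=L$, where $\overline{\operatorname{ext}}$ denotes the closure of the set of extreme points. An affine $G$-flow $K$ is proximally irreducible if every proximally irreducible extension $\phi\colon L\to K$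 is an isomorphism (a homeomorphism). For a $G$-flow $X$, let $P(X)$ be the set of regular Borel probability measures on $X$, viewed as a subset of $C(X)^*$ with the weak-$*$ topology, with $G$ acting by push-forward. Then $P(\Pi(G))$ is a proximally irreducible affine $G$-flow. -/

import Mathlib

open Set Filter Topology MeasureTheory

universe u v w

/-! Throughout, a `G`-flow is a compact Hausdorff space `X` with a continuous action of `G`, i.e.
`[TopologicalSpace X] [CompactSpace X] [T2Space X] [MulAction G X] [ContinuousSMul G X]`. -/

section Flows

variable (G : Type u) [Group G]

/-- A minimal flow: nonempty, and every orbit is dense. -/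
structure IsMinimalFlow (X : Type v) [TopologicalSpace X] [MulAction G X] : Prop where
  nonempty : Nonempty X
  minimal : MulAction.IsMinimal G X

/-- A proximal flow: for all `x, y` there is a net `g_i` in `G` (here: a filter on `G`) along which
`g_i x` and `g_i y` converge to the same point. -/
def IsProximalFlow (X : Type v) [TopologicalSpace X] [MulAction G X] : Prop :=
  ∀ x y : X, ∃ (F : Filter G) (z : X), F.NeBot ∧
    Tendsto (fun g : G => g • x) F (𝓝 z) ∧ Tendsto (fun g : G => g • y) F (𝓝 z)

/-- An extension of flows: a continuous equivariant surjection. -/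
structure IsFlowExtension {X : Type v} {Y : Type w} [TopologicalSpace X] [MulAction G X]
    [TopologicalSpace Y] [MulAction G Y] (φ : X → Y) : Prop where
  continuous : Continuous φ
  map_smul : ∀ (g : G) (x : X), φ (g • x) = g • φ x
  surjective : Function.Surjective φ

/-- The universal property of `Π(G)`: a minimal proximal flow which is an extension of every
minimal proximal flow. -/
structure IsUniversalMinimalProximalFlow (X : Type v) [TopologicalSpace X] [CompactSpace X]
    [T2Space X] [TopologicalSpace G] [MulAction G X] [ContinuousSMul G X] : Prop where
  minimal : IsMinimalFlow G X
  proximal : IsProximalFlow G X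
  universal : ∀ (Y : Type w) [TopologicalSpace Y] [CompactSpace Y] [T2Space Y] [MulAction G Y]
    [ContinuousSMul G Y], IsMinimalFlow G Y → IsProximalFlow G Y →
      ∃ φ : X → Y, IsFlowExtension G φ

/-- A nonempty closed invariant set. -/
structure IsSubflow {X : Type v} [TopologicalSpace X] [MulAction G X] (M : Set X) : Prop where
  closed : IsClosed M
  nonempty : M.Nonempty
  smul_mem : ∀ (g : G) (x : X), x ∈ M → g • x ∈ M

theorem exists_minimal_subflow (X : Type v) [TopologicalSpace X] [CompactSpace X] [Nonempty X]
    [MulAction G X] : ∃ M : Set X, IsSubflow G M ∧ ∀ N, IsSubflow G N → N ⊆ M → N = M := by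
  obtain ⟨M, -, hM⟩ := zorn_superset_nonempty {M : Set X | IsSubflow G M}
    (fun c hc hchain hne => by
      refine ⟨⋂₀ c, ⟨isClosed_sInter fun s hs => (hc hs).closed, ?_, ?_⟩,
        fun s hs => sInter_subset_of_mem hs⟩
      · have : Nonempty c := hne.to_subtype
        exact IsCompact.nonempty_sInter_of_directed_nonempty_isCompact_isClosed
          (fun a ha b hb => (hchain.total ha hb).elim
            (fun h => ⟨a, ha, subset_rfl, h⟩) (fun h => ⟨b, hb, h, subset_rfl⟩)) (fun s hs => (hc hs).nonempty)
          (fun s hs => (hc hs).closed.isCompact) (fun s hs => (hc hs).closed)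
      · intro g x hx s hs
        exact (hc hs).smul_mem g x (hx s hs))
    univ ⟨isClosed_univ, univ_nonempty, fun _ _ _ => trivial⟩
  exact ⟨M, hM.prop, fun N hN hNM => hM.eq_of_subset hN hNM⟩

variable {G}

theorem IsMinimalFlow.eq_univ {X : Type v} [TopologicalSpace X] [MulAction G X]
    (hX : IsMinimalFlow G X) {N : Set X} (hN : IsSubflow G N) : N = univ := by
  have := hX.minimal
  refine (eq_empty_or_univ_of_smul_invariant_closed G hN.closed ?_).resolve_left
    hN.nonempty.ne_empty
  rintro g _ ⟨x, hx, rfl⟩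
  exact hN.smul_mem g x hx

theorem IsMinimalFlow.of_subflows {X : Type v} [TopologicalSpace X] [MulAction G X]
    [ContinuousConstSMul G X] [Nonempty X] (h : ∀ N : Set X, IsSubflow G N → N = univ) :
    IsMinimalFlow G X := by
  refine ⟨inferInstance, (isMinimal_iff_isClosed_smul_invariant G).2 fun s hs hinv => ?_⟩
  rcases s.eq_empty_or_nonempty with he | hne
  · exact Or.inl he
  · exact Or.inr (h s ⟨hs, hne, fun g x hx => hinv g ⟨x, hx, rfl⟩⟩)

/-- An equivariant continuous map to a minimal flow is surjective. -/
theorem IsMinimalFlow.surjective {X : Type v} {Y : Type w} [TopologicalSpace X] [CompactSpace X]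
    [Nonempty X] [MulAction G X] [TopologicalSpace Y] [T2Space Y] [MulAction G Y]
    (hY : IsMinimalFlow G Y) {φ : X → Y} (hc : Continuous φ)
    (hs : ∀ (g : G) (x : X), φ (g • x) = g • φ x) : Function.Surjective φ := by
  rw [← range_eq_univ]
  refine hY.eq_univ ⟨(isCompact_range hc).isClosed, range_nonempty φ, ?_⟩
  rintro g _ ⟨x, rfl⟩
  exact ⟨g • x, hs g x⟩

variable (G) [TopologicalSpace G]

/-! ### Construction of the universal minimal proximal flow

Every minimal flow has at most `2 ^ (2 ^ |G|)` points, hence is isomorphic to one whose underlying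
set consists of families of subsets of `G`. `Π(G)` is a minimal subflow of the product of all
minimal proximal flows of this kind. -/

/-- A minimal proximal flow whose underlying set is a set of families of subsets of `G`. -/
structure MinProxModel : Type u where
  carrier : Set (Set (Set G))
  [top : TopologicalSpace carrier]
  [compact : CompactSpace carrier]
  [t2 : T2Space carrier]
  [act : MulAction G carrier]
  [cont : ContinuousSMul G carrier]
  minimal : IsMinimalFlow G carrier
  proximal : IsProximalFlow G carrier

attribute [instance] MinProxModel.top MinProxModel.compact MinProxModel.t2 MinProxModel.act
  MinProxModel.cont

/-- The product of all minimal proximal flows. -/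
abbrev MinProxProduct : Type u := ∀ i : MinProxModel G, i.carrier

instance : Nonempty (MinProxProduct G) := ⟨fun i => (i.minimal.nonempty).some⟩

/-- A minimal subflow of the product of all minimal proximal flows. -/
noncomputable def minProxSubflow : Set (MinProxProduct G) :=
  (exists_minimal_subflow G (MinProxProduct G)).choose

theorem minProxSubflow_isSubflow : IsSubflow G (minProxSubflow G) :=
  (exists_minimal_subflow G (MinProxProduct G)).choose_spec.1

theorem minProxSubflow_minimal (N : Set (MinProxProduct G)) (hN : IsSubflow G N)
    (h : N ⊆ minProxSubflow G) : N = minProxSubflow G :=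
  (exists_minimal_subflow G (MinProxProduct G)).choose_spec.2 N hN h

/-- The universal minimal proximal flow `Π(G)`. -/
def UMPF : Type u := minProxSubflow G

instance : TopologicalSpace (UMPF G) := inferInstanceAs (TopologicalSpace (minProxSubflow G))

instance : CompactSpace (UMPF G) :=
  isCompact_iff_compactSpace.1 (minProxSubflow_isSubflow G).closed.isCompact

instance : T2Space (UMPF G) := inferInstanceAs (T2Space (minProxSubflow G))

instance : MulAction G (UMPF G) where
  smul g x := ⟨g • x.1, (minProxSubflow_isSubflow G).smul_mem g x.1 x.2⟩
  one_smul x := Subtype.ext (one_smul G x.1)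
  mul_smul g h x := Subtype.ext (mul_smul g h x.1)

instance : ContinuousSMul G (UMPF G) where
  continuous_smul := Continuous.subtype_mk
    (continuous_fst.smul (continuous_subtype_val.comp continuous_snd)) _

variable {G}

theorem MinProxProduct.isProximalFlow : IsProximalFlow G (MinProxProduct G) := by
  intro x y
  -- a minimal subflow of the orbit closure of `(x, y)`
  let Z := MinProxProduct G
  let O : Set (Z × Z) := closure (MulAction.orbit G (x, y))
  have hO : IsSubflow G O := by
    refine ⟨isClosed_closure, (MulAction.nonempty_orbit _).closure, fun g p hp => ?_⟩
    exact smul_closure_orbit_subset g (x, y) ⟨p, hp, rfl⟩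
  have : CompactSpace O := isCompact_iff_compactSpace.1 hO.closed.isCompact
  have : Nonempty O := hO.nonempty.to_subtype
  let _ : MulAction G O :=
    { smul := fun g p => ⟨g • p.1, hO.smul_mem g p.1 p.2⟩
      one_smul := fun p => Subtype.ext (one_smul G p.1)
      mul_smul := fun g h p => Subtype.ext (mul_smul g h p.1) }
  have hval : ∀ (g : G) (p : O), ((g • p : O) : Z × Z) = g • (p : Z × Z) := fun _ _ => rfl
  obtain ⟨N, hN, hmin⟩ := exists_minimal_subflow G O
  have key : ∀ i : MinProxModel G, ∀ p ∈ N, (p : Z × Z).1 i = (p : Z × Z).2 i := by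
    intro i
    let N' : Set O := N ∩ {p | (p : Z × Z).1 i = (p : Z × Z).2 i}
    have hc1 : Continuous fun p : O => (p : Z × Z).1 i := by fun_prop
    have hc2 : Continuous fun p : O => (p : Z × Z).2 i := by fun_prop
    have hsub : IsSubflow G N' := by
      refine ⟨hN.closed.inter (isClosed_eq hc1 hc2), ?_, ?_⟩
      · obtain ⟨p, hp⟩ := hN.nonempty
        obtain ⟨F, z, hF, h1, h2⟩ := i.proximal ((p : Z × Z).1 i) ((p : Z × Z).2 i)
        let U : Ultrafilter G := Ultrafilter.of F
        have hU : (U : Filter G) ≤ F := Ultrafilter.of_le F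
        have hmem : ∀ᶠ q in ((U.map fun g => g • p : Ultrafilter O) : Filter O), q ∈ N :=
          Filter.Eventually.of_forall (f := (U : Filter G)) (p := fun g => g • p ∈ N)
            (fun g => hN.smul_mem g p hp)
        obtain ⟨q, hq, hlim⟩ :=
          hN.closed.isCompact.ultrafilter_le_nhds (U.map fun g => g • p) (le_principal_iff.2 hmem)
        have hlim' : Tendsto (fun g => g • p) (U : Filter G) (𝓝 q) := hlim
        have e1 : (q : Z × Z).1 i = z :=
          tendsto_nhds_unique ((hc1.tendsto q).comp hlim') (h1.mono_left hU)
        have e2 : (q : Z × Z).2 i = z :=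
          tendsto_nhds_unique ((hc2.tendsto q).comp hlim') (h2.mono_left hU)
        exact ⟨q, hq, e1.trans e2.symm⟩
      · rintro g p ⟨hp, he⟩
        refine ⟨hN.smul_mem g p hp, ?_⟩
        change g • (p : Z × Z).1 i = g • (p : Z × Z).2 i
        exact congrArg (g • ·) he
    have := hmin N' hsub inter_subset_left
    intro p hp
    rw [← this] at hp
    exact hp.2
  obtain ⟨p, hp⟩ := hN.nonempty
  have hdiag : (p : Z × Z).1 = (p : Z × Z).2 := funext fun i => key i p hp
  have hcl : (p : Z × Z) ∈ closure (range fun g : G => g • ((x, y) : Z × Z)) := p.2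
  refine ⟨comap (fun g : G => g • ((x, y) : Z × Z)) (𝓝 (p : Z × Z)), (p : Z × Z).1, ?_, ?_, ?_⟩
  · refine comap_neBot fun t ht => ?_
    obtain ⟨_, hq, g, rfl⟩ := mem_closure_iff_nhds.1 hcl t ht
    exact ⟨g, hq⟩
  · exact (continuous_fst.tendsto (p : Z × Z)).comp tendsto_comap
  · rw [hdiag]
    exact (continuous_snd.tendsto (p : Z × Z)).comp tendsto_comap

theorem UMPF.isMinimalFlow : IsMinimalFlow G (UMPF G) := by
  have : Nonempty (UMPF G) := (minProxSubflow_isSubflow G).nonempty.to_subtype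
  refine IsMinimalFlow.of_subflows fun N hN => ?_
  have hcl : IsClosed (minProxSubflow G) := (minProxSubflow_isSubflow G).closed
  have hsub : IsSubflow G (Subtype.val '' N : Set (MinProxProduct G)) := by
    refine ⟨hcl.isClosedMap_subtype_val N hN.closed, hN.nonempty.image _, ?_⟩
    rintro g _ ⟨(x : UMPF G), hx, rfl⟩
    exact ⟨(g • x : UMPF G), hN.smul_mem g x hx, rfl⟩
  have := minProxSubflow_minimal G _ hsub (by rintro _ ⟨x, _, rfl⟩; exact x.2)
  refine eq_univ_of_forall fun x => ?_
  have hx : x.1 ∈ (Subtype.val '' N : Set (MinProxProduct G)) := by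
    rw [this]
    exact x.2
  obtain ⟨y, hy, hyx⟩ := hx
  exact (Subtype.ext hyx : y = x) ▸ hy

theorem UMPF.isProximalFlow : IsProximalFlow G (UMPF G) := by
  intro x y
  obtain ⟨F, z, hF, h1, h2⟩ := MinProxProduct.isProximalFlow (G := G) x.1 y.1
  have hz : z ∈ minProxSubflow G :=
    (minProxSubflow_isSubflow G).closed.mem_of_tendsto h1
      (Eventually.of_forall fun g => (minProxSubflow_isSubflow G).smul_mem g x.1 x.2)
  exact ⟨F, ⟨z, hz⟩, hF, tendsto_subtype_rng.2 h1, tendsto_subtype_rng.2 h2⟩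

/-- Every minimal proximal flow is isomorphic to one in `MinProxModel G`. -/
theorem exists_minProxModel (Y : Type w) [TopologicalSpace Y] [CompactSpace Y] [T2Space Y]
    [MulAction G Y] [ContinuousSMul G Y] (hm : IsMinimalFlow G Y) (hp : IsProximalFlow G Y) :
    ∃ (i : MinProxModel G) (φ : i.carrier → Y), Continuous φ ∧
      ∀ (g : G) (x : i.carrier), φ (g • x) = g • φ x := by
  obtain ⟨y₀⟩ := hm.nonempty
  let j : Y → Set (Set G) := fun y => {A | y ∈ closure ((fun g : G => g • y₀) '' A)}
  have hj : Function.Injective j := by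
    intro a b hab
    by_contra hne
    obtain ⟨U, V, hU, hV, ha, hb, hUV⟩ := t2_separation hne
    have hA : {g : G | g • y₀ ∈ U} ∈ j a := by
      change a ∈ closure _
      rw [mem_closure_iff]
      intro W hW haW
      have := hm.minimal
      obtain ⟨g, hg⟩ := (hW.inter hU).exists_smul_mem G y₀ ⟨a, haW, ha⟩
      exact ⟨g • y₀, hg.1, g, hg.2, rfl⟩
    rw [hab] at hA
    obtain ⟨_, hzV, g, hg, rfl⟩ := mem_closure_iff.1 hA V hV hb
    exact disjoint_left.1 hUV hg hzV
  let e : Y ≃ range j := Equiv.ofInjective j hj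
  let _ : TopologicalSpace (range j) := TopologicalSpace.coinduced e inferInstance
  let h : Y ≃ₜ range j := e.toHomeomorph fun s => by
    rw [isOpen_coinduced]
  have _ : CompactSpace (range j) := h.compactSpace
  have _ : T2Space (range j) := h.t2Space
  let _ : MulAction G (range j) := e.symm.mulAction G
  have hsm : ∀ (g : G) (x : range j), h.symm (g • x) = g • h.symm x :=
    fun g x => e.symm_apply_apply _
  have hsm' : ∀ (g : G) (x : range j), g • x = h (g • h.symm x) := fun _ _ => rfl
  have _ : ContinuousSMul G (range j) := by
    refine ⟨?_⟩
    simp only [hsm']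
    fun_prop
  refine ⟨⟨range j, ⟨⟨h y₀⟩, ⟨fun x => ?_⟩⟩, fun x y => ?_⟩, h.symm, h.symm.continuous, hsm⟩
  · have := hm.minimal
    have hd : DenseRange fun g : G => h (g • h.symm x) :=
      h.surjective.denseRange.comp (denseRange_smul G (h.symm x)) h.continuous
    exact hd
  · obtain ⟨F, z, hF, h1, h2⟩ := hp (h.symm x) (h.symm y)
    exact ⟨F, h z, hF, (h.continuous.tendsto z).comp h1, (h.continuous.tendsto z).comp h2⟩

/-- `UMPF G` has the universal property of the universal minimal proximal flow, with respect to
minimal proximal flows in every universe. -/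
theorem UMPF.isUniversal : IsUniversalMinimalProximalFlow.{u, u, w} G (UMPF G) := by
  refine ⟨UMPF.isMinimalFlow, UMPF.isProximalFlow, fun Y _ _ _ _ _ hm hp => ?_⟩
  obtain ⟨i, φ, hc, hs⟩ := exists_minProxModel Y hm hp
  have hc' : Continuous fun x : UMPF G => φ (x.1 i) :=
    hc.comp ((continuous_apply i).comp continuous_subtype_val)
  have hs' : ∀ (g : G) (x : UMPF G), φ ((g • x).1 i) = g • φ (x.1 i) :=
    fun g x => hs g (x.1 i)
  have : Nonempty (UMPF G) := UMPF.isMinimalFlow.nonempty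
  exact ⟨fun x => φ (x.1 i), hc', hs', hm.surjective hc' hs'⟩

end Flows

section AffineFlows

variable (G : Type u) [Group G]

/-- An affine map between convex sets: it preserves convex combinations. -/
def IsAffineMap {E : Type v} {F : Type w} [AddCommGroup E] [Module ℝ E] [AddCommGroup F]
    [Module ℝ F] {K : Set E} {L : Set F} (φ : K → L) : Prop :=
  ∀ (x y z : K) (a b : ℝ), 0 ≤ a → 0 ≤ b → a + b = 1 →
    (z : E) = a • (x : E) + b • (y : E) → (φ z : F) = a • (φ x : F) + b • (φ y : F)

/-- An affine `G`-flow: a nonempty compact convex set in a Hausdorff locally convex space with a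
continuous action of `G` by affine maps (which are then affine homeomorphisms). -/
structure IsAffineFlow [TopologicalSpace G] {E : Type v} [AddCommGroup E] [Module ℝ E]
    [TopologicalSpace E] [IsTopologicalAddGroup E] [ContinuousSMul ℝ E] [LocallyConvexSpace ℝ E]
    [T2Space E] (K : Set E) [MulAction G K] : Prop where
  nonempty : K.Nonempty
  isCompact : IsCompact K
  convex : Convex ℝ K
  continuousSMul : ContinuousSMul G K
  affine : ∀ g : G, IsAffineMap fun x : K => g • x

/-- An affine subflow of `K`: a nonempty compact convex `G`-invariant subset. -/
structure IsAffineSubflow {E : Type v} [AddCommGroup E] [Module ℝ E] [TopologicalSpace E]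
    (K : Set E) [MulAction G K] (C : Set E) : Prop where
  nonempty : C.Nonempty
  subset : C ⊆ K
  isCompact : IsCompact C
  convex : Convex ℝ C
  smul_mem : ∀ (g : G) (x : K), (x : E) ∈ C → ((g • x : K) : E) ∈ C

/-- An affine extension: a continuous equivariant affine surjection. -/
structure IsAffineExtension {E : Type v} {F : Type w} [AddCommGroup E] [Module ℝ E]
    [TopologicalSpace E] [AddCommGroup F] [Module ℝ F] [TopologicalSpace F] {L : Set E}
    {K : Set F} [MulAction G L] [MulAction G K] (φ : L → K) : Prop
    extends IsFlowExtension G φ where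
  affine : IsAffineMap φ

/-- A proximally irreducible extension `φ : L → K`: the only affine subflow `C ⊆ L` that meets
`conv (cl (ext L) ∩ φ⁻¹{y})` for all `y ∈ cl (ext K)` is `L` itself. -/
structure IsProximallyIrreducibleExtension {E : Type v} {F : Type w} [AddCommGroup E] [Module ℝ E]
    [TopologicalSpace E] [AddCommGroup F] [Module ℝ F] [TopologicalSpace F] {L : Set E}
    {K : Set F} [MulAction G L] [MulAction G K] (φ : L → K) : Prop
    extends IsAffineExtension G φ where
  eq_of_meets : ∀ C : Set E, IsAffineSubflow G L C →
    (∀ y : K, (y : F) ∈ closure (K.extremePoints ℝ) →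
      (C ∩ convexHull ℝ
        (closure (L.extremePoints ℝ) ∩ Subtype.val '' (φ ⁻¹' {y}))).Nonempty) →
    C = L

/-- `K` is a proximally irreducible affine `G`-flow: it is an affine `G`-flow and each of its
proximally irreducible extensions (by affine flows `L` in arbitrary locally convex spaces) is an
isomorphism. -/
structure IsProximallyIrreducibleFlow [TopologicalSpace G] {F : Type v} [AddCommGroup F]
    [Module ℝ F] [TopologicalSpace F] [IsTopologicalAddGroup F] [ContinuousSMul ℝ F]
    [LocallyConvexSpace ℝ F] [T2Space F] (K : Set F) [MulAction G K] : Prop where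
  isAffineFlow : IsAffineFlow G K
  isHomeomorph : ∀ (E : Type w) [AddCommGroup E] [Module ℝ E] [TopologicalSpace E]
    [IsTopologicalAddGroup E] [ContinuousSMul ℝ E] [LocallyConvexSpace ℝ E] [T2Space E]
    (L : Set E) [MulAction G L], IsAffineFlow G L →
      ∀ φ : L → K, IsProximallyIrreducibleExtension G φ → IsHomeomorph φ

instance {V : Type v} [NormedAddCommGroup V] [NormedSpace ℝ V] :
    LocallyConvexSpace ℝ (WeakDual ℝ V) :=
  inferInstanceAs (LocallyConvexSpace ℝ (WeakBilin (topDualPairing ℝ V)))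

/-- `P(X)`: the regular Borel probability measures on a compact Hausdorff space `X`, viewed via
integration as elements of the dual of `C(X)` with the weak-* topology. -/
def probMeasures (X : Type v) [TopologicalSpace X] [CompactSpace X] [T2Space X] :
    Set (WeakDual ℝ C(X, ℝ)) :=
  let _ : MeasurableSpace X := borel X
  {Λ | ∃ μ : Measure X, IsProbabilityMeasure μ ∧ μ.Regular ∧ ∀ f : C(X, ℝ), Λ f = ∫ x, f x ∂μ}

/-- The translation `f ↦ f(g ·)` as a continuous linear map on `C(X)`. -/
noncomputable def compSmul {G : Type u} [Group G] (X : Type v) [TopologicalSpace X]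
    [CompactSpace X] [MulAction G X] [ContinuousConstSMul G X] (g : G) :
    C(X, ℝ) →L[ℝ] C(X, ℝ) where
  toFun f := f.comp ⟨fun x => g • x, continuous_const_smul g⟩
  map_add' _ _ := rfl
  map_smul' _ _ := rfl
  cont := ContinuousMap.continuous_precomp _

/-- The action of `G` on `P(X)` by push-forward, `∫ f d(gμ) = ∫ f(g x) dμ(x)`. -/
noncomputable instance probMeasures.mulAction (X : Type v) [TopologicalSpace X] [CompactSpace X]
    [T2Space X] [MulAction G X] [ContinuousConstSMul G X] : MulAction G (probMeasures X) where
  smul g Λ := ⟨StrongDual.toWeakDual ((WeakDual.toStrongDual Λ.1).comp (compSmul X g)), by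
    let _ : MeasurableSpace X := borel X
    have _ : BorelSpace X := ⟨rfl⟩
    obtain ⟨μ, hμ, hreg, h⟩ := Λ.2
    have hm : Measurable fun x : X => g • x := (continuous_const_smul g).measurable
    refine ⟨μ.map fun x => g • x, Measure.isProbabilityMeasure_map hm.aemeasurable,
      Measure.Regular.map (Homeomorph.smul g), fun f => ?_⟩
    rw [integral_map hm.aemeasurable f.continuous.aestronglyMeasurable]
    exact h (compSmul X g f)⟩
  one_smul Λ := by
    apply Subtype.ext
    apply DFunLike.ext
    intro f
    change Λ.1 (compSmul X (1 : G) f) = Λ.1 f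
    congr 1
    ext x
    exact congrArg f (one_smul G x)
  mul_smul g h Λ := by
    apply Subtype.ext
    apply DFunLike.ext
    intro f
    change Λ.1 (compSmul X (g * h) f) = Λ.1 (compSmul X h (compSmul X g f))
    congr 1
    ext x
    exact congrArg f (mul_smul g h x)

theorem probMeasures.smul_apply (X : Type v) [TopologicalSpace X] [CompactSpace X] [T2Space X]
    [MulAction G X] [ContinuousConstSMul G X] (g : G) (Λ : probMeasures X) (f : C(X, ℝ)) :
    (g • Λ).1 f = Λ.1 (f.comp ⟨fun x => g • x, continuous_const_smul g⟩) := rfl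

end AffineFlows

/-!
Let `φ : L → K` be a proximally irreducible extension and write `∂` for the closure of the extreme
points. If `∂K` is a minimal flow, irreducibility forces every subflow of `∂L` lying over `∂K` to
generate `L` as a closed convex set, so by Milman's theorem `∂L` is itself minimal. Moreover, if
`p, q ∈ ∂L` lie in one fibre of `φ`, the midpoints of the pairs in the orbit closure of `(p, q)`
also generate `L`; so, again by Milman, some extreme point of `L` is such a midpoint, and its
endpoints coincide: `(p, q)` is proximal. Hence `∂L` is proximal as soon as `∂K` is.

For `K = P(Π(G))` the boundary `∂K` is `Π(G)`, embedded as the point masses. So `∂L` is minimal and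
proximal and there is an extension `ψ : Π(G) → ∂L`. Minimality and proximality of `Π(G)` force
`φ (ψ x)` to be the point mass at `x`, and then every continuous affine function on `L` can be
recovered from `φ`, which is therefore injective.
-/

section Convexity

variable {E : Type*} [AddCommGroup E] [Module ℝ E] [TopologicalSpace E] [ContinuousSMul ℝ E]

theorem isCompact_convexJoin [ContinuousAdd E] {s t : Set E}
    (hs : IsCompact s) (ht : IsCompact t) : IsCompact (convexJoin ℝ s t) := by
  have h : convexJoin ℝ s t = (fun p : ℝ × E × E => (1 - p.1) • p.2.1 + p.1 • p.2.2) ''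
      (Icc (0 : ℝ) 1 ×ˢ s ×ˢ t) := by
    ext x
    simp only [mem_convexJoin, segment_eq_image, mem_image, Prod.exists, mem_prod]
    constructor
    · rintro ⟨a, ha, b, hb, θ, hθ, rfl⟩
      exact ⟨θ, a, b, ⟨hθ, ha, hb⟩, rfl⟩
    · rintro ⟨θ, a, b, ⟨hθ, ha, hb⟩, rfl⟩
      exact ⟨a, ha, b, hb, θ, hθ, rfl⟩
  rw [h]
  exact (isCompact_Icc.prod (hs.prod ht)).image (by fun_prop)

variable [IsTopologicalAddGroup E] [T2Space E]

theorem closedConvexHull_union_subset_convexJoin {s t : Set E} (hs : s.Nonempty) (ht : t.Nonempty)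
    (hsc : IsCompact (closedConvexHull ℝ s)) (htc : IsCompact (closedConvexHull ℝ t)) :
    closedConvexHull ℝ (s ∪ t) ⊆ convexJoin ℝ (closedConvexHull ℝ s) (closedConvexHull ℝ t) := by
  rw [closedConvexHull_eq_closure_convexHull, convexHull_union hs ht]
  exact closure_minimal
    (convexJoin_mono convexHull_subset_closedConvexHull convexHull_subset_closedConvexHull)
    (isCompact_convexJoin hsc htc).isClosed

theorem mem_closedConvexHull_or_of_mem_extremePoints {K s t : Set E} (hK : IsCompact K)
    (hs : closedConvexHull ℝ s ⊆ K) (ht : closedConvexHull ℝ t ⊆ K) {e : E}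
    (he : e ∈ K.extremePoints ℝ) (h : e ∈ closedConvexHull ℝ (s ∪ t)) :
    e ∈ closedConvexHull ℝ s ∨ e ∈ closedConvexHull ℝ t := by
  rcases s.eq_empty_or_nonempty with rfl | hs₀
  · exact Or.inr (by rwa [empty_union] at h)
  rcases t.eq_empty_or_nonempty with rfl | ht₀
  · exact Or.inl (by rwa [union_empty] at h)
  have hsc := hK.of_isClosed_subset isClosed_closedConvexHull hs
  have htc := hK.of_isClosed_subset isClosed_closedConvexHull ht
  obtain ⟨a, ha, b, hb, hab⟩ :=
    mem_convexJoin.1 (closedConvexHull_union_subset_convexJoin hs₀ ht₀ hsc htc h)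
  rcases (mem_extremePoints_iff_forall_segment.1 he).2 a (hs ha) b (ht hb) hab with rfl | rfl
  · exact Or.inl ha
  · exact Or.inr hb

theorem exists_mem_nhds_notMem_closedConvexHull [LocallyConvexSpace ℝ E] {x e : E} (hxe : x ≠ e) :
    ∃ U ∈ 𝓝 x, e ∉ closedConvexHull ℝ U := by
  obtain ⟨f, hf⟩ := geometric_hahn_banach_point_point hxe
  obtain ⟨c, hxc, hce⟩ := exists_between hf
  have hsub : closedConvexHull ℝ {y | f y < c} ⊆ {y | f y ≤ c} :=
    closedConvexHull_min (fun y (hy : f y < c) => hy.le)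
      (convex_halfSpace_le f.toLinearMap.isLinear c) (isClosed_le f.continuous continuous_const)
  exact ⟨{y | f y < c}, (isOpen_lt f.continuous continuous_const).mem_nhds hxc,
    fun he => (hsub he).not_gt hce⟩

/-- **Milman's theorem**. If `e ∉ S`, cover the compact set `S` by finitely many neighbourhoods
whose closed convex hulls omit `e`; an extreme point in the hull of a union is in one of the
hulls. -/
theorem extremePoints_closedConvexHull_subset [LocallyConvexSpace ℝ E] {S : Set E}
    (hS : IsCompact S) (hK : IsCompact (closedConvexHull ℝ S)) :
    (closedConvexHull ℝ S).extremePoints ℝ ⊆ S := by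
  intro e he
  by_contra heS
  have hull_inter_subset (t : Set E) : closedConvexHull ℝ (t ∩ S) ⊆ closedConvexHull ℝ S :=
    (closedConvexHull ℝ).monotone inter_subset_right
  suffices he' : e ∉ closedConvexHull ℝ (S ∩ S) by
    rw [inter_self] at he'
    exact he' he.1
  refine hS.induction_on (p := fun t => e ∉ closedConvexHull ℝ (t ∩ S)) ?empty ?mono ?union ?nhds
  case empty => simp [closedConvexHull_eq_closure_convexHull]
  case mono =>
    exact fun s t hst ht hs => ht ((closedConvexHull ℝ).monotone (inter_subset_inter_left S hst) hs)
  case union =>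
    intro s t hs ht hst
    rw [union_inter_distrib_right] at hst
    exact (mem_closedConvexHull_or_of_mem_extremePoints hK (hull_inter_subset s)
      (hull_inter_subset t) he hst).elim hs ht
  case nhds =>
    intro x hx
    obtain ⟨U, hU, heU⟩ := exists_mem_nhds_notMem_closedConvexHull (ne_of_mem_of_not_mem hx heS)
    exact ⟨U, mem_nhdsWithin_of_mem_nhds hU,
      fun h => heU ((closedConvexHull ℝ).monotone inter_subset_left h)⟩

end Convexity

section AffineMaps

variable {E F : Type*} [AddCommGroup E] [Module ℝ E] [AddCommGroup F] [Module ℝ F]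
  {L : Set E} {K : Set F} {φ : L → K}

theorem IsAffineMap.convex_setOf_graph_mem (hφ : IsAffineMap φ) (hL : Convex ℝ L)
    {T : Set (E × F)} (hT : Convex ℝ T) :
    Convex ℝ (Subtype.val '' {x : L | ((x : E), (φ x : F)) ∈ T}) := by
  rintro _ ⟨x, hx, rfl⟩ _ ⟨y, hy, rfl⟩ a b ha hb hab
  let z : L := ⟨a • (x : E) + b • (y : E), hL x.2 y.2 ha hb hab⟩
  have hz : (φ z : F) = a • (φ x : F) + b • (φ y : F) := hφ x y z a b ha hb hab rfl
  refine ⟨z, ?_, rfl⟩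
  simp only [mem_ofPred_eq, hz]
  exact hT hx hy ha hb hab

theorem IsAffineMap.isExtreme_image_fiber (hφ : IsAffineMap φ) {y : K}
    (hy : (y : F) ∈ K.extremePoints ℝ) : IsExtreme ℝ L (Subtype.val '' (φ ⁻¹' {y})) := by
  refine ⟨Subtype.coe_image_subset _ _, ?_⟩
  rintro x₁ hx₁ x₂ hx₂ _ ⟨x, rfl, rfl⟩ ⟨a, b, ha, hb, hab, hx⟩
  have hφx := hφ ⟨x₁, hx₁⟩ ⟨x₂, hx₂⟩ x a b ha.le hb.le hab hx.symm
  exact ⟨⟨x₁, hx₁⟩,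
    Subtype.ext (hy.2 (φ ⟨x₁, hx₁⟩).2 (φ ⟨x₂, hx₂⟩).2 ⟨a, b, ha, hb, hab, hφx.symm⟩), rfl⟩

/-- The midpoint of two points of a convex set, as a point of that set. -/
noncomputable def convexMidpoint (hL : Convex ℝ L) (p : L × L) : L :=
  ⟨midpoint ℝ (p.1 : E) p.2, hL.midpoint_mem p.1.2 p.2.2⟩

theorem coe_convexMidpoint (hL : Convex ℝ L) (p : L × L) :
    (convexMidpoint hL p : E) = (2⁻¹ : ℝ) • (p.1 : E) + (2⁻¹ : ℝ) • (p.2 : E) := by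
  simp only [convexMidpoint, midpoint_eq_smul_add, smul_add, invOf_eq_inv]

theorem IsAffineMap.map_convexMidpoint (hφ : IsAffineMap φ) (hL : Convex ℝ L) (hK : Convex ℝ K)
    (p : L × L) : φ (convexMidpoint hL p) = convexMidpoint hK (p.map φ φ) := by
  have hmap := hφ p.1 p.2 _ _ _ (by norm_num) (by norm_num) (by norm_num) (coe_convexMidpoint hL p)
  exact Subtype.ext (hmap.trans (coe_convexMidpoint hK (p.map φ φ)).symm)

theorem convexMidpoint_self (hL : Convex ℝ L) (x : L) : convexMidpoint hL (x, x) = x :=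
  Subtype.ext (midpoint_self ℝ (x : E))

theorem fst_eq_snd_of_convexMidpoint_mem_extremePoints (hL : Convex ℝ L) {p : L × L}
    (hp : (convexMidpoint hL p : E) ∈ L.extremePoints ℝ) : p.1 = p.2 := by
  obtain ⟨h₁, h₂⟩ := (mem_extremePoints.1 hp).2 _ p.1.2 _ p.2.2 (midpoint_mem_openSegment _ _)
  exact Subtype.ext (h₁.trans h₂.symm)

theorem continuous_convexMidpoint [TopologicalSpace E] [ContinuousAdd E] [ContinuousSMul ℝ E]
    (hL : Convex ℝ L) : Continuous (convexMidpoint hL) := by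
  refine Continuous.subtype_mk ?_ _
  simp only [midpoint_eq_smul_add]
  fun_prop

end AffineMaps

section ExtremeBoundary

variable {E : Type*} [AddCommGroup E] [Module ℝ E] [TopologicalSpace E]

/-- The closed extreme boundary of a convex set `L`: the closure of the set of its extreme points,
as a set of points of `L`. -/
def extremeBoundary (L : Set E) : Set L := Subtype.val ⁻¹' closure (L.extremePoints ℝ)

theorem isClosed_extremeBoundary (L : Set E) : IsClosed (extremeBoundary L) :=
  isClosed_closure.preimage continuous_subtype_val

theorem extremeBoundary_eq_closure (L : Set E) :
    extremeBoundary L = closure (Subtype.val ⁻¹' L.extremePoints ℝ) := by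
  ext x
  rw [closure_subtype, Subtype.image_preimage_coe, inter_eq_right.2 extremePoints_subset]
  rfl

variable [IsTopologicalAddGroup E] [ContinuousSMul ℝ E] [LocallyConvexSpace ℝ E] [T2Space E]
  {L : Set E}

theorem closedConvexHull_image_extremeBoundary (hL : IsCompact L) (hLc : Convex ℝ L) :
    closedConvexHull ℝ (Subtype.val '' extremeBoundary L) = L := by
  have himage : Subtype.val '' extremeBoundary L = closure (L.extremePoints ℝ) := by
    rw [extremeBoundary, Subtype.image_preimage_coe, inter_eq_right]
    exact closure_minimal extremePoints_subset hL.isClosed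
  rw [himage, closedConvexHull_closure_eq_closedConvexHull, closedConvexHull_eq_closure_convexHull,
    closure_convexHull_extremePoints hL hLc]

theorem extremeBoundary_subset_of_closedConvexHull_eq (hL : IsCompact L) {N : Set L}
    (hN : IsClosed N) (h : closedConvexHull ℝ (Subtype.val '' N) = L) : extremeBoundary L ⊆ N := by
  have : CompactSpace L := isCompact_iff_compactSpace.1 hL
  rw [extremeBoundary_eq_closure]
  refine closure_minimal (fun x hx => ?_) hN
  have hmilman := extremePoints_closedConvexHull_subset (hN.isCompact.image continuous_subtype_val)
    (h.symm ▸ hL)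
  rw [h] at hmilman
  exact Subtype.val_injective.mem_set_image.1 (hmilman hx)

theorem IsAffineMap.exists_mem_extremePoints {F : Type*} [AddCommGroup F] [Module ℝ F]
    [TopologicalSpace F] [T1Space F] {K : Set F} {φ : L → K} (hφ : IsAffineMap φ)
    (hcont : Continuous φ) (hsurj : Function.Surjective φ) (hL : IsCompact L) {y : K}
    (hy : (y : F) ∈ K.extremePoints ℝ) : ∃ x : L, (x : E) ∈ L.extremePoints ℝ ∧ φ x = y := by
  have hclosed : IsClosed (Subtype.val '' (φ ⁻¹' {y}) : Set E) :=
    hL.isClosed.isClosedMap_subtype_val _ (isClosed_singleton.preimage hcont)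
  have hextreme := hφ.isExtreme_image_fiber hy
  obtain ⟨e, he⟩ := (hL.of_isClosed_subset hclosed hextreme.subset).extremePoints_nonempty
    ((show (φ ⁻¹' {y}).Nonempty from hsurj y).image _)
  obtain ⟨x, hx, rfl⟩ := he.1
  exact ⟨x, hextreme.extremePoints_subset_extremePoints he, hx⟩

end ExtremeBoundary

section Flows

variable {G : Type*} [Group G] {X Y : Type*} [TopologicalSpace X] [MulAction G X]
  [TopologicalSpace Y] [MulAction G Y] {M : Set X}

theorem IsSubflow.image (hM : IsSubflow G M) {f : X → Y} (hf : IsClosedMap f)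
    (hfs : ∀ (g : G) (x : X), f (g • x) = g • f x) : IsSubflow G (f '' M) where
  closed := hf M hM.closed
  nonempty := hM.nonempty.image f
  smul_mem := by
    rintro g _ ⟨x, hx, rfl⟩
    exact ⟨g • x, hM.smul_mem g x hx, hfs g x⟩

theorem IsSubflow.preimage {N : Set Y} (hN : IsSubflow G N) {f : X → Y} (hf : Continuous f)
    (hfs : ∀ (g : G) (x : X), f (g • x) = g • f x) (hne : (f ⁻¹' N).Nonempty) :
    IsSubflow G (f ⁻¹' N) where
  closed := hN.closed.preimage hf
  nonempty := hne
  smul_mem g x hx := by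
    rw [mem_preimage, hfs]
    exact hN.smul_mem g _ hx

theorem isSubflow_setOf_eq [T2Space Y] {f f' : X → Y} (hf : Continuous f) (hf' : Continuous f')
    (hfs : ∀ (g : G) (x : X), f (g • x) = g • f x)
    (hfs' : ∀ (g : G) (x : X), f' (g • x) = g • f' x) {x : X} (hx : f x = f' x) :
    IsSubflow G {x | f x = f' x} where
  closed := isClosed_eq hf hf'
  nonempty := ⟨x, hx⟩
  smul_mem g x hx := by
    rw [mem_ofPred_eq, hfs, hfs']
    exact congrArg (g • ·) hx

theorem isSubflow_closure_orbit [ContinuousConstSMul G X] (x : X) :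
    IsSubflow G (closure (MulAction.orbit G x)) where
  closed := isClosed_closure
  nonempty := (MulAction.nonempty_orbit x).closure
  smul_mem g y hy := smul_closure_orbit_subset g x ⟨y, hy, rfl⟩

theorem IsSubflow.closure_orbit_subset (hM : IsSubflow G M) {x : X} (hx : x ∈ M) :
    closure (MulAction.orbit G x) ⊆ M :=
  closure_minimal (range_subset_iff.2 fun g => hM.smul_mem g x hx) hM.closed

/-- A subflow with the restricted action. -/
def IsSubflow.toSubMulAction (hM : IsSubflow G M) : SubMulAction G X where
  carrier := M
  smul_mem' g x hx := hM.smul_mem g x hx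

theorem IsSubflow.compactSpace [CompactSpace X] (hM : IsSubflow G M) :
    CompactSpace hM.toSubMulAction :=
  isCompact_iff_compactSpace.1 hM.closed.isCompact

theorem IsSubflow.image_coe (hM : IsSubflow G M) {N : Set hM.toSubMulAction}
    (hN : IsSubflow G N) : IsSubflow G (Subtype.val '' N : Set X) :=
  hN.image (IsClosed.isClosedMap_subtype_val hM.closed) fun _ _ => rfl

theorem IsSubflow.exists_minimal [CompactSpace X] (hM : IsSubflow G M) :
    ∃ N ⊆ M, Minimal (IsSubflow G) N := by
  have := hM.compactSpace
  have : Nonempty hM.toSubMulAction := hM.nonempty.to_subtype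
  obtain ⟨N, hN, hmin⟩ := exists_minimal_subflow G hM.toSubMulAction
  refine ⟨Subtype.val '' N, Subtype.coe_image_subset _ _, hM.image_coe hN, fun N' hN' hsub => ?_⟩
  have hpreimage : IsSubflow G (Subtype.val ⁻¹' N' : Set hM.toSubMulAction) := by
    refine hN'.preimage continuous_subtype_val (fun _ _ => rfl) ?_
    obtain ⟨x, hx⟩ := hN'.nonempty
    obtain ⟨y, -, rfl⟩ := hsub hx
    exact ⟨y, hx⟩
  rw [← hmin _ hpreimage fun x hx => Subtype.val_injective.mem_set_image.1 (hsub hx)]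
  exact image_preimage_subset _ _

theorem isMinimalFlow_toSubMulAction [ContinuousConstSMul G X] (hM : Minimal (IsSubflow G) M) :
    IsMinimalFlow G hM.prop.toSubMulAction := by
  have : ContinuousConstSMul G hM.prop.toSubMulAction :=
    ⟨fun g => (continuous_subtype_val.const_smul g).subtype_mk _⟩
  have : Nonempty hM.prop.toSubMulAction := hM.prop.nonempty.to_subtype
  refine IsMinimalFlow.of_subflows fun N hN => ?_
  have himage : Subtype.val '' N = M :=
    hM.eq_of_subset (hM.prop.image_coe hN) (Subtype.coe_image_subset _ _)
  exact eq_univ_of_forall fun x => Subtype.val_injective.mem_set_image.1 (himage.symm ▸ x.2)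

theorem IsMinimalFlow.minimal_range [CompactSpace X] [T2Space Y] (hX : IsMinimalFlow G X)
    {f : X → Y} (hf : Continuous f) (hfs : ∀ (g : G) (x : X), f (g • x) = g • f x) :
    Minimal (IsSubflow G) (range f) := by
  have := hX.nonempty
  have huniv : IsSubflow G (univ : Set X) := ⟨isClosed_univ, univ_nonempty, fun _ _ _ => trivial⟩
  refine ⟨image_univ (f := f) ▸ huniv.image hf.isClosedMap hfs, fun N hN hsub => ?_⟩
  have hpreimage : IsSubflow G (f ⁻¹' N) := by
    refine hN.preimage hf hfs ?_
    obtain ⟨y, hy⟩ := hN.nonempty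
    obtain ⟨x, rfl⟩ := hsub hy
    exact ⟨x, hy⟩
  exact range_subset_iff.2 fun x => eq_univ_iff_forall.1 (hX.eq_univ hpreimage) x

end Flows

section Proximality

variable {G : Type*} [Group G] {X Y : Type*} [TopologicalSpace X] [MulAction G X]
  [TopologicalSpace Y] [MulAction G Y]

variable (G) in
/-- Two points of a flow are proximal if the orbit closure of the pair meets the diagonal, i.e. if
some net in `G` moves both points to the same limit. -/
def IsProximalPair (x y : X) : Prop := ∃ z, (z, z) ∈ closure (MulAction.orbit G (x, y))

theorem isProximalPair_iff_exists_tendsto {x y : X} :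
    IsProximalPair G x y ↔ ∃ (F : Filter G) (z : X), F.NeBot ∧
      Tendsto (fun g : G => g • x) F (𝓝 z) ∧ Tendsto (fun g : G => g • y) F (𝓝 z) := by
  constructor
  · rintro ⟨z, hz⟩
    have hlim : Tendsto (fun g : G => g • (x, y)) (comap (fun g : G => g • (x, y)) (𝓝 (z, z)))
      (𝓝 (z, z)) := tendsto_comap
    refine ⟨_, z, comap_neBot_iff.2 fun t ht => ?_, hlim.fst_nhds, hlim.snd_nhds⟩
    obtain ⟨_, hgt, g, rfl⟩ := mem_closure_iff_nhds.1 hz t ht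
    exact ⟨g, hgt⟩
  · rintro ⟨F, z, hF, hx, hy⟩
    exact ⟨z, mem_closure_of_tendsto (hx.prodMk_nhds hy)
      (Eventually.of_forall fun g => MulAction.mem_orbit (x, y) g)⟩

theorem IsProximalFlow.isProximalPair (hX : IsProximalFlow G X) (x y : X) : IsProximalPair G x y :=
  isProximalPair_iff_exists_tendsto.2 (hX x y)

theorem IsSubflow.isProximalFlow {M : Set X} (hM : IsSubflow G M)
    (h : ∀ x ∈ M, ∀ y ∈ M, IsProximalPair G x y) : IsProximalFlow G hM.toSubMulAction := by
  intro x y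
  obtain ⟨F, z, hF, hx, hy⟩ := isProximalPair_iff_exists_tendsto.1 (h x x.2 y y.2)
  have hz : z ∈ M :=
    hM.closed.mem_of_tendsto hx (Eventually.of_forall fun g => hM.smul_mem g x x.2)
  exact ⟨F, ⟨z, hz⟩, hF, tendsto_subtype_rng.2 hx, tendsto_subtype_rng.2 hy⟩

theorem IsProximalPair.map {x y : X} (h : IsProximalPair G x y) {f : X → Y} (hf : Continuous f)
    (hfs : ∀ (g : G) (x : X), f (g • x) = g • f x) : IsProximalPair G (f x) (f y) := by
  obtain ⟨z, hz⟩ := h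
  refine ⟨f z, map_mem_closure (f := Prod.map f f) (hf.prodMap hf) hz ?_⟩
  rintro _ ⟨g, rfl⟩
  exact ⟨g, Prod.ext (hfs g x).symm (hfs g y).symm⟩

theorem IsProximalPair.exists_mem_closure_orbit_map_eq [CompactSpace X] [T2Space Y]
    [ContinuousConstSMul G X] {f : X → Y} (hf : Continuous f)
    (hfs : ∀ (g : G) (x : X), f (g • x) = g • f x) {x y : X} (h : IsProximalPair G (f x) (f y)) :
    ∃ p ∈ closure (MulAction.orbit G (x, y)), f p.1 = f p.2 := by
  obtain ⟨z, hz⟩ := h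
  have himage : IsSubflow G (Prod.map f f '' closure (MulAction.orbit G (x, y))) :=
    (isSubflow_closure_orbit (x, y)).image (hf.prodMap hf).isClosedMap
      fun g p => Prod.ext (hfs g p.1) (hfs g p.2)
  obtain ⟨p, hp, hpz⟩ := himage.closure_orbit_subset
    (mem_image_of_mem _ (subset_closure (MulAction.mem_orbit_self (x, y)))) hz
  exact ⟨p, hp, (Prod.ext_iff.1 hpz).1.trans (Prod.ext_iff.1 hpz).2.symm⟩

theorem IsMinimalFlow.eq_of_isProximalFlow [T2Space Y] (hmin : IsMinimalFlow G X)
    (hprox : IsProximalFlow G X) {f f' : X → Y} (hf : Continuous f) (hf' : Continuous f')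
    (hfs : ∀ (g : G) (x : X), f (g • x) = g • f x)
    (hfs' : ∀ (g : G) (x : X), f' (g • x) = g • f' x) {x y : X} (hxy : f x = f' y) : f = f' := by
  obtain ⟨z, hz⟩ := hprox.isProximalPair x y
  have hgraph : IsSubflow G {p : X × X | f p.1 = f' p.2} :=
    isSubflow_setOf_eq (hf.comp continuous_fst) (hf'.comp continuous_snd)
      (fun g p => hfs g p.1) (fun g p => hfs' g p.2) (x := (x, y)) hxy
  have heqLocus : IsSubflow G {x | f x = f' x} :=
    isSubflow_setOf_eq hf hf' hfs hfs' (hgraph.closure_orbit_subset hxy hz)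
  exact funext fun x => eq_univ_iff_forall.1 (hmin.eq_univ heqLocus) x

end Proximality

theorem IsUniversalMinimalProximalFlow.exists_range_eq {G : Type u} [Group G] [TopologicalSpace G]
    {X : Type v} [TopologicalSpace X] [CompactSpace X] [T2Space X] [MulAction G X]
    [ContinuousSMul G X] {Y : Type w} [TopologicalSpace Y] [CompactSpace Y] [T2Space Y]
    [MulAction G Y] [ContinuousSMul G Y] (hX : IsUniversalMinimalProximalFlow.{u, v, w} G X)
    {M : Set Y} (hM : Minimal (IsSubflow G) M) (h : ∀ x ∈ M, ∀ y ∈ M, IsProximalPair G x y) :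
    ∃ f : X → Y, Continuous f ∧ (∀ (g : G) (x : X), f (g • x) = g • f x) ∧ range f = M := by
  have := hM.prop.compactSpace
  obtain ⟨f, hf⟩ := hX.universal _ (isMinimalFlow_toSubMulAction hM) (hM.prop.isProximalFlow h)
  refine ⟨Subtype.val ∘ f, continuous_subtype_val.comp hf.continuous,
    fun g x => congrArg Subtype.val (hf.map_smul g x), ?_⟩
  exact (hf.surjective.range_comp Subtype.val).trans Subtype.range_coe

section AffineFlows

variable {G : Type*} [Group G] [TopologicalSpace G] {E : Type*} [AddCommGroup E] [Module ℝ E]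
  [TopologicalSpace E] [IsTopologicalAddGroup E] [ContinuousSMul ℝ E] [LocallyConvexSpace ℝ E]
  [T2Space E] {L : Set E} [MulAction G L]

theorem IsAffineFlow.smul_mem_extremePoints (hL : IsAffineFlow G L) (g : G) {x : L}
    (hx : (x : E) ∈ L.extremePoints ℝ) : ((g • x : L) : E) ∈ L.extremePoints ℝ := by
  refine ⟨(g • x).2, ?_⟩
  rintro y hy z hz ⟨a, b, ha, hb, hab, h⟩
  have hinv := hL.affine g⁻¹ ⟨y, hy⟩ ⟨z, hz⟩ (g • x) a b ha.le hb.le hab h.symm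
  simp only [inv_smul_smul] at hinv
  have hy_eq := hx.2 (g⁻¹ • (⟨y, hy⟩ : L)).2 (g⁻¹ • (⟨z, hz⟩ : L)).2
    ⟨a, b, ha, hb, hab, hinv.symm⟩
  rw [← Subtype.ext hy_eq, smul_inv_smul]

theorem IsAffineFlow.isSubflow_extremeBoundary (hL : IsAffineFlow G L) :
    IsSubflow G (extremeBoundary L) where
  closed := isClosed_extremeBoundary L
  nonempty := by
    obtain ⟨x, hx⟩ := hL.isCompact.extremePoints_nonempty hL.nonempty
    exact ⟨⟨x, hx.1⟩, subset_closure hx⟩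
  smul_mem g x hx := by
    have := hL.continuousSMul
    rw [extremeBoundary_eq_closure] at hx ⊢
    exact map_mem_closure (continuous_const_smul g) hx fun _ => hL.smul_mem_extremePoints g

theorem IsAffineFlow.isAffineSubflow_closedConvexHull (hL : IsAffineFlow G L) {N : Set L}
    (hN : IsSubflow G N) : IsAffineSubflow G L (closedConvexHull ℝ (Subtype.val '' N)) := by
  have := hL.continuousSMul
  set C := closedConvexHull ℝ (Subtype.val '' N : Set E)
  have hCL : C ⊆ L := closedConvexHull_min (Subtype.coe_image_subset L N) hL.convex
    hL.isCompact.isClosed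
  refine ⟨(hN.nonempty.image _).mono subset_closedConvexHull, hCL,
    hL.isCompact.of_isClosed_subset isClosed_closedConvexHull hCL, convex_closedConvexHull,
    fun g x hx => ?_⟩
  let P : Set L := {x | ((g • x : L) : E) ∈ C}
  have hP : IsClosed P := isClosed_closedConvexHull.preimage (by fun_prop)
  have hPc : Convex ℝ (Subtype.val '' P) :=
    (hL.affine g).convex_setOf_graph_mem hL.convex (T := Prod.snd ⁻¹' C)
      (convex_closedConvexHull.linear_preimage (LinearMap.snd ℝ E E))
  have hNP : N ⊆ P := fun y hy =>
    subset_closedConvexHull (mem_image_of_mem _ (hN.smul_mem g y hy))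
  exact Subtype.val_injective.mem_set_image.1 <| closedConvexHull_min (image_mono hNP) hPc
    (hL.isCompact.isClosed.isClosedMap_subtype_val _ hP) hx

theorem IsAffineFlow.isSubflow_image_convexMidpoint (hL : IsAffineFlow G L) {S : Set (L × L)}
    (hS : IsSubflow G S) : IsSubflow G (convexMidpoint hL.convex '' S) := by
  have : CompactSpace L := isCompact_iff_compactSpace.1 hL.isCompact
  exact hS.image (continuous_convexMidpoint hL.convex).isClosedMap
    fun g p => ((hL.affine g).map_convexMidpoint hL.convex hL.convex p).symm

end AffineFlows

section IrreducibleExtensions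

variable {G : Type*} [Group G] [TopologicalSpace G]
  {E : Type*} [AddCommGroup E] [Module ℝ E] [TopologicalSpace E] [IsTopologicalAddGroup E]
  [ContinuousSMul ℝ E] [LocallyConvexSpace ℝ E] [T2Space E] {L : Set E} [MulAction G L]
  {F : Type*} [AddCommGroup F] [Module ℝ F] [TopologicalSpace F] [T2Space F] {K : Set F}
  [MulAction G K] {φ : L → K}

theorem IsProximallyIrreducibleExtension.closedConvexHull_eq
    (hφ : IsProximallyIrreducibleExtension G φ) (hL : IsAffineFlow G L)
    (hK : Minimal (IsSubflow G) (extremeBoundary K)) {N : Set L}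
    (hN : IsSubflow G N) (hNK : ∀ x ∈ N, φ x ∈ extremeBoundary K)
    (hNL : ∀ x ∈ N, (x : E) ∈ convexHull ℝ (Subtype.val '' (extremeBoundary L ∩ φ ⁻¹' {φ x}))) :
    closedConvexHull ℝ (Subtype.val '' N) = L := by
  have : CompactSpace L := isCompact_iff_compactSpace.1 hL.isCompact
  have himage : φ '' N = extremeBoundary K :=
    hK.eq_of_subset (hN.image hφ.continuous.isClosedMap hφ.map_smul) (image_subset_iff.2 hNK)
  refine hφ.eq_of_meets _ (hL.isAffineSubflow_closedConvexHull hN) fun y hy => ?_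
  obtain ⟨x, hx, rfl⟩ : y ∈ φ '' N := himage.symm ▸ hy
  refine ⟨x, subset_closedConvexHull (mem_image_of_mem _ hx), ?_⟩
  rw [← image_preimage_inter]
  exact hNL x hx

variable [IsTopologicalAddGroup F] [ContinuousSMul ℝ F] [LocallyConvexSpace ℝ F]

theorem IsAffineExtension.isSubflow_extremeBoundary_inter (hφ : IsAffineExtension G φ)
    (hL : IsAffineFlow G L) (hK : IsAffineFlow G K) :
    IsSubflow G (extremeBoundary L ∩ φ ⁻¹' extremeBoundary K) where
  closed := (isClosed_extremeBoundary L).inter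
    ((isClosed_extremeBoundary K).preimage hφ.continuous)
  nonempty := by
    obtain ⟨y, hy⟩ := hK.isCompact.extremePoints_nonempty hK.nonempty
    obtain ⟨x, hx, hxy⟩ := hφ.affine.exists_mem_extremePoints hφ.continuous hφ.surjective
      hL.isCompact (y := ⟨y, hy.1⟩) hy
    refine ⟨x, subset_closure hx, ?_⟩
    rw [mem_preimage, hxy]
    exact subset_closure hy
  smul_mem g x hx := by
    refine ⟨hL.isSubflow_extremeBoundary.smul_mem g x hx.1, ?_⟩
    rw [mem_preimage, hφ.map_smul]
    exact hK.isSubflow_extremeBoundary.smul_mem g _ hx.2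

namespace IsProximallyIrreducibleExtension

theorem minimal_extremeBoundary (hφ : IsProximallyIrreducibleExtension G φ)
    (hL : IsAffineFlow G L) (hK : IsAffineFlow G K)
    (hKmin : Minimal (IsSubflow G) (extremeBoundary K)) :
    Minimal (IsSubflow G) (extremeBoundary L) := by
  have : CompactSpace L := isCompact_iff_compactSpace.1 hL.isCompact
  obtain ⟨M, hsub, hM⟩ :=
    (hφ.toIsAffineExtension.isSubflow_extremeBoundary_inter hL hK).exists_minimal
  have hgen : closedConvexHull ℝ (Subtype.val '' M) = L :=
    hφ.closedConvexHull_eq hL hKmin hM.prop (fun x hx => (hsub hx).2)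
      fun x hx => subset_convexHull ℝ _ ⟨x, ⟨(hsub hx).1, rfl⟩, rfl⟩
  have hLM : extremeBoundary L ⊆ M :=
    extremeBoundary_subset_of_closedConvexHull_eq hL.isCompact hM.prop.closed hgen
  rwa [hLM.antisymm fun x hx => (hsub hx).1]

theorem mapsTo_extremeBoundary (hφ : IsProximallyIrreducibleExtension G φ)
    (hL : IsAffineFlow G L) (hK : IsAffineFlow G K)
    (hKmin : Minimal (IsSubflow G) (extremeBoundary K)) :
    MapsTo φ (extremeBoundary L) (extremeBoundary K) := by
  have hinter := hφ.toIsAffineExtension.isSubflow_extremeBoundary_inter hL hK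
  exact inter_eq_left.1
    ((hφ.minimal_extremeBoundary hL hK hKmin).eq_of_subset hinter inter_subset_left)

/-- The midpoints of the pairs in `S` generate `L`, so one of them is an extreme point. -/
theorem exists_diag_mem (hφ : IsProximallyIrreducibleExtension G φ)
    (hL : IsAffineFlow G L) (hK : IsAffineFlow G K)
    (hKmin : Minimal (IsSubflow G) (extremeBoundary K)) {S : Set (L × L)} (hS : IsSubflow G S)
    (hSL : S ⊆ extremeBoundary L ×ˢ extremeBoundary L) (hSφ : ∀ p ∈ S, φ p.1 = φ p.2) :
    ∃ x, (x, x) ∈ S := by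
  have hmid := hL.isSubflow_image_convexMidpoint hS
  have map_mid : ∀ p ∈ S, φ (convexMidpoint hL.convex p) = φ p.1 := fun p hp => by
    rw [hφ.affine.map_convexMidpoint hL.convex hK.convex, Prod.map_apply', ← hSφ p hp,
      convexMidpoint_self]
  have hgen : closedConvexHull ℝ (Subtype.val '' (convexMidpoint hL.convex '' S)) = L := by
    refine hφ.closedConvexHull_eq hL hKmin hmid ?_ ?_
    · rintro _ ⟨p, hp, rfl⟩
      rw [map_mid p hp]
      exact hφ.mapsTo_extremeBoundary hL hK hKmin (hSL hp).1
    · rintro _ ⟨p, hp, rfl⟩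
      rw [map_mid p hp]
      exact (convex_convexHull ℝ _).midpoint_mem
        (subset_convexHull ℝ _ ⟨p.1, ⟨(hSL hp).1, rfl⟩, rfl⟩)
        (subset_convexHull ℝ _ ⟨p.2, ⟨(hSL hp).2, (hSφ p hp).symm⟩, rfl⟩)
  obtain ⟨e, he⟩ := hL.isCompact.extremePoints_nonempty hL.nonempty
  obtain ⟨⟨x, y⟩, hp, hpe⟩ := extremeBoundary_subset_of_closedConvexHull_eq hL.isCompact
    hmid.closed hgen (subset_closure he : (⟨e, he.1⟩ : L) ∈ extremeBoundary L)
  obtain rfl : x = y := fst_eq_snd_of_convexMidpoint_mem_extremePoints hL.convex (by rwa [hpe])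
  exact ⟨x, hp⟩

theorem isProximalPair_of_map (hφ : IsProximallyIrreducibleExtension G φ)
    (hL : IsAffineFlow G L) (hK : IsAffineFlow G K)
    (hKmin : Minimal (IsSubflow G) (extremeBoundary K)) {x y : L} (hx : x ∈ extremeBoundary L)
    (hy : y ∈ extremeBoundary L) (h : IsProximalPair G (φ x) (φ y)) : IsProximalPair G x y := by
  have := hL.continuousSMul
  have : CompactSpace L := isCompact_iff_compactSpace.1 hL.isCompact
  have horbit : closure (MulAction.orbit G (x, y)) ⊆ extremeBoundary L ×ˢ extremeBoundary L :=
    closure_minimal (range_subset_iff.2 fun g =>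
      ⟨hL.isSubflow_extremeBoundary.smul_mem g x hx, hL.isSubflow_extremeBoundary.smul_mem g y hy⟩)
      ((isClosed_extremeBoundary L).prod (isClosed_extremeBoundary L))
  obtain ⟨p, hp, hpφ⟩ := h.exists_mem_closure_orbit_map_eq hφ.continuous hφ.map_smul
  have hfiber : IsSubflow G {p : L × L | φ p.1 = φ p.2} :=
    isSubflow_setOf_eq (hφ.continuous.comp continuous_fst) (hφ.continuous.comp continuous_snd)
      (fun g p => hφ.map_smul g p.1) (fun g p => hφ.map_smul g p.2) hpφ
  have hsub := (isSubflow_closure_orbit (x, y)).closure_orbit_subset hp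
  obtain ⟨z, hz⟩ := hφ.exists_diag_mem hL hK hKmin (isSubflow_closure_orbit p)
    (hsub.trans horbit) (hfiber.closure_orbit_subset hpφ)
  exact ⟨z, hsub hz⟩

end IsProximallyIrreducibleExtension

end IrreducibleExtensions

namespace probMeasures

variable {X : Type*} [TopologicalSpace X] [CompactSpace X] [T2Space X]

theorem mem_iff {Λ : WeakDual ℝ C(X, ℝ)} :
    Λ ∈ probMeasures X ↔ Λ 1 = 1 ∧ ∀ f : C(X, ℝ), 0 ≤ f → 0 ≤ Λ f := by
  let _ : MeasurableSpace X := borel X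
  have _ : BorelSpace X := ⟨rfl⟩
  constructor
  · rintro ⟨μ, hμ, -, hΛ⟩
    exact ⟨by simp [hΛ], fun f hf => (hΛ f).symm ▸ integral_nonneg hf⟩
  · rintro ⟨hone, hpos⟩
    let Φ : CompactlySupportedContinuousMap X ℝ →ₚ[ℝ] ℝ :=
      PositiveLinearMap.mk₀
        { toFun := fun f => Λ f.toContinuousMap
          map_add' := fun f g => map_add Λ f.toContinuousMap g.toContinuousMap
          map_smul' := fun c f => map_smul Λ c f.toContinuousMap }
        fun f hf => hpos f.toContinuousMap hf
    have hΛ (f : C(X, ℝ)) : Λ f = ∫ x, f x ∂(RealRMK.rieszMeasure Φ) :=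
      (RealRMK.integral_rieszMeasure Φ ⟨f, HasCompactSupport.of_compactSpace _⟩).symm
    refine ⟨RealRMK.rieszMeasure Φ, ⟨?_⟩, inferInstance, hΛ⟩
    rw [← ENNReal.toReal_eq_one_iff, ← hone, hΛ 1]
    simp [Measure.real]

theorem apply_mono {Λ : WeakDual ℝ C(X, ℝ)} (hΛ : Λ ∈ probMeasures X) {f g : C(X, ℝ)}
    (hfg : f ≤ g) : Λ f ≤ Λ g := by
  rw [← sub_nonneg, ← map_sub]
  exact (mem_iff.1 hΛ).2 _ (sub_nonneg.2 hfg)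

theorem apply_const {Λ : WeakDual ℝ C(X, ℝ)} (hΛ : Λ ∈ probMeasures X) (c : ℝ) :
    Λ (ContinuousMap.const X c) = c := by
  have hconst : ContinuousMap.const X c = c • (1 : C(X, ℝ)) := by ext; simp
  rw [hconst, map_smul, (mem_iff.1 hΛ).1, smul_eq_mul, mul_one]

theorem abs_apply_le_apply_abs {Λ : WeakDual ℝ C(X, ℝ)} (hΛ : Λ ∈ probMeasures X)
    (f : C(X, ℝ)) : |Λ f| ≤ Λ |f| :=
  abs_le'.2 ⟨apply_mono hΛ (le_abs_self f), map_neg Λ f ▸ apply_mono hΛ (neg_le_abs f)⟩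

theorem abs_apply_le_norm {Λ : WeakDual ℝ C(X, ℝ)} (hΛ : Λ ∈ probMeasures X) (f : C(X, ℝ)) :
    |Λ f| ≤ ‖f‖ :=
  calc |Λ f| ≤ Λ |f| := abs_apply_le_apply_abs hΛ f
    _ ≤ Λ (ContinuousMap.const X ‖f‖) := apply_mono hΛ f.norm_coe_le_norm
    _ = ‖f‖ := apply_const hΛ ‖f‖

variable (X) in
theorem isCompact : IsCompact (probMeasures X) := by
  have hclosed : IsClosed (probMeasures X) := by
    have heq : probMeasures X = {Λ | Λ 1 = 1} ∩ ⋂ (f : C(X, ℝ)) (_ : 0 ≤ f), {Λ | 0 ≤ Λ f} :=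
      Set.ext fun Λ => by simp only [mem_iff, mem_inter_iff, mem_iInter, mem_ofPred_eq]
    rw [heq]
    exact (isClosed_eq (WeakDual.eval_continuous _) continuous_const).inter
      (isClosed_iInter fun f => isClosed_iInter fun _ =>
        isClosed_le continuous_const (WeakDual.eval_continuous f))
  refine (WeakDual.isCompact_closedBall (0 : StrongDual ℝ C(X, ℝ)) 1).of_isClosed_subset hclosed
    fun Λ hΛ => ?_
  rw [mem_preimage, mem_closedBall_zero_iff]
  exact ContinuousLinearMap.opNorm_le_bound _ zero_le_one fun f =>
    (abs_apply_le_norm hΛ f).trans_eq (one_mul _).symm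

variable (X) in
theorem convex : Convex ℝ (probMeasures X) := by
  intro Λ hΛ Λ' hΛ' a b ha hb hab
  rw [mem_iff] at *
  refine ⟨?_, fun f hf => add_nonneg (mul_nonneg ha (hΛ.2 f hf)) (mul_nonneg hb (hΛ'.2 f hf))⟩
  change a * Λ 1 + b * Λ' 1 = 1
  rw [hΛ.1, hΛ'.1, mul_one, mul_one, hab]

theorem continuous_eval : Continuous fun p : C(X, ℝ) × probMeasures X => p.2.1 p.1 := by
  refine continuous_prod_of_continuous_lipschitzWith _ 1
    (fun f => (WeakDual.eval_continuous f).comp continuous_subtype_val)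
    fun Λ => LipschitzWith.of_dist_le_mul fun f f' => ?_
  rw [NNReal.coe_one, one_mul, Real.dist_eq, dist_eq_norm, ← map_sub]
  exact abs_apply_le_norm Λ.2 (f - f')

/-- The point mass at `x`. -/
noncomputable def dirac (x : X) : probMeasures X :=
  ⟨StrongDual.toWeakDual (ContinuousMap.evalCLM ℝ x), mem_iff.2 ⟨rfl, fun _ hf => hf x⟩⟩

theorem dirac_apply (x : X) (f : C(X, ℝ)) : (dirac x).1 f = f x := rfl

theorem continuous_dirac : Continuous (dirac : X → probMeasures X) :=
  Continuous.subtype_mk (WeakDual.continuous_of_continuous_eval fun f => f.continuous) _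

variable (X) in
theorem closedConvexHull_range_dirac :
    closedConvexHull ℝ (Subtype.val '' range (dirac (X := X))) = probMeasures X := by
  refine (closedConvexHull_min (Subtype.coe_image_subset _ _) (convex X)
    (isCompact X).isClosed).antisymm fun Λ hΛ => ?_
  by_contra hΛhull
  obtain ⟨ℓ, c, hc, hcΛ⟩ := geometric_hahn_banach_closed_point convex_closedConvexHull
    isClosed_closedConvexHull hΛhull
  obtain ⟨f, rfl⟩ := LinearMap.dualEmbedding_surjective (topDualPairing ℝ C(X, ℝ)) ℓ
  have hf : f ≤ ContinuousMap.const X c := fun x =>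
    (hc (dirac x).1 (subset_closedConvexHull (mem_image_of_mem _ (mem_range_self x)))).le
  exact ((apply_mono hΛ hf).trans_eq (apply_const hΛ c)).not_gt hcΛ

/-- If `dirac x` is a proper convex combination of `Λ` and `Λ'`, then `Λ` vanishes on
`|f - f x|`. -/
theorem dirac_mem_extremePoints (x : X) : (dirac x).1 ∈ (probMeasures X).extremePoints ℝ := by
  refine ⟨(dirac x).2, ?_⟩
  rintro Λ hΛ Λ' hΛ' ⟨a, b, ha, hb, -, hx⟩
  refine DFunLike.ext _ _ fun f => ?_
  set h : C(X, ℝ) := f - ContinuousMap.const X (f x)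
  have hcomb : a * Λ |h| + b * Λ' |h| = 0 := by
    refine (DFunLike.congr_fun hx |h|).trans ?_
    simp [dirac_apply, h]
  have hpos : 0 ≤ b * Λ' |h| := mul_nonneg hb.le ((mem_iff.1 hΛ').2 _ (abs_nonneg h))
  have hzero : Λ |h| ≤ 0 := nonpos_of_mul_nonpos_right (by linarith) ha
  have hΛh : Λ h = 0 := abs_nonpos_iff.1 ((abs_apply_le_apply_abs hΛ h).trans hzero)
  rw [map_sub, apply_const hΛ] at hΛh
  exact sub_eq_zero.1 hΛh

variable (X) in
theorem extremeBoundary_eq_range_dirac :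
    extremeBoundary (probMeasures X) = range (dirac (X := X)) :=
  (extremeBoundary_subset_of_closedConvexHull_eq (isCompact X)
    (isCompact_range continuous_dirac).isClosed (closedConvexHull_range_dirac X)).antisymm
    (range_subset_iff.2 fun x => subset_closure (dirac_mem_extremePoints x))

section Action

variable {G : Type*} [Group G] [MulAction G X]

theorem dirac_smul [ContinuousConstSMul G X] (g : G) (x : X) : dirac (g • x) = g • dirac x := rfl

theorem minimal_extremeBoundary [ContinuousConstSMul G X] (hX : IsMinimalFlow G X) :
    Minimal (IsSubflow G) (extremeBoundary (probMeasures X)) :=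
  extremeBoundary_eq_range_dirac X ▸ hX.minimal_range continuous_dirac dirac_smul

theorem isProximalPair_of_mem_extremeBoundary [ContinuousConstSMul G X] (hX : IsProximalFlow G X)
    {Λ Λ' : probMeasures X} (hΛ : Λ ∈ extremeBoundary (probMeasures X))
    (hΛ' : Λ' ∈ extremeBoundary (probMeasures X)) : IsProximalPair G Λ Λ' := by
  rw [extremeBoundary_eq_range_dirac] at hΛ hΛ'
  obtain ⟨x, rfl⟩ := hΛ
  obtain ⟨y, rfl⟩ := hΛ'
  exact (hX.isProximalPair x y).map continuous_dirac dirac_smul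

variable [TopologicalSpace G] [ContinuousSMul G X]

variable (X G) in
theorem continuousSMul : ContinuousSMul G (probMeasures X) := by
  refine ⟨Continuous.subtype_mk (WeakDual.continuous_of_continuous_eval fun f => ?_) _⟩
  have htranslate : Continuous fun g : G => compSmul X g f :=
    ContinuousMap.continuous_of_continuous_uncurry _ (f.continuous.comp continuous_smul)
  exact continuous_eval.comp (htranslate.prodMap continuous_id)

variable (X G) in
theorem isAffineFlow [Nonempty X] : IsAffineFlow G (probMeasures X) where
  nonempty := ⟨_, (dirac (Classical.arbitrary X)).2⟩
  isCompact := isCompact X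
  convex := convex X
  continuousSMul := continuousSMul X G
  affine g _ _ _ _ _ _ _ _ h :=
    DFunLike.ext _ _ fun f => DFunLike.congr_fun h (compSmul X g f)

end Action

section AffineSection

variable {E : Type*} [AddCommGroup E] [Module ℝ E] [TopologicalSpace E] {L : Set E}
  {φ : L → probMeasures X} {ψ : X → L}

theorem apply_comp_of_section [T2Space E] (hL : IsCompact L) (hLc : Convex ℝ L)
    (hφ : IsAffineMap φ) (hφc : Continuous φ) (hφψ : ∀ x, φ (ψ x) = dirac x)
    (hψ : closedConvexHull ℝ (Subtype.val '' range ψ) = L) (ℓ : E →L[ℝ] ℝ) {f : C(X, ℝ)}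
    (hf : ∀ x, f x = ℓ (ψ x)) (y : L) : (φ y).1 f = ℓ y := by
  let A : Set L := {y | (φ y).1 f = ℓ y}
  have hA : IsClosed A :=
    isClosed_eq ((WeakDual.eval_continuous f).comp (continuous_subtype_val.comp hφc)) (by fun_prop)
  have hAc : Convex ℝ (Subtype.val '' A) := by
    refine hφ.convex_setOf_graph_mem hLc (T := {p | p.2 f = ℓ p.1}) ?_
    rintro ⟨e, Λ⟩ (hp : Λ f = ℓ e) ⟨e', Λ'⟩ (hq : Λ' f = ℓ e') a b - - -
    change a * Λ f + b * Λ' f = ℓ (a • e + b • e')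
    rw [hp, hq, map_add, map_smul, map_smul, smul_eq_mul, smul_eq_mul]
  have hψA : range ψ ⊆ A := range_subset_iff.2 fun x =>
    show (φ (ψ x)).1 f = ℓ (ψ x) by rw [hφψ, dirac_apply, hf]
  have hLA : L ⊆ Subtype.val '' A := hψ.symm.subset.trans <|
    closedConvexHull_min (image_mono hψA) hAc (hL.isClosed.isClosedMap_subtype_val _ hA)
  exact Subtype.val_injective.mem_set_image.1 (hLA y.2)

theorem injective_of_section [IsTopologicalAddGroup E] [ContinuousSMul ℝ E]
    [LocallyConvexSpace ℝ E] [T2Space E] (hL : IsCompact L) (hLc : Convex ℝ L)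
    (hφ : IsAffineMap φ) (hφc : Continuous φ) (hψc : Continuous ψ)
    (hφψ : ∀ x, φ (ψ x) = dirac x) (hψ : closedConvexHull ℝ (Subtype.val '' range ψ) = L) :
    Function.Injective φ := by
  intro y z hyz
  by_contra hne
  obtain ⟨ℓ, hℓ⟩ := geometric_hahn_banach_point_point (Subtype.coe_ne_coe.2 hne)
  let f : C(X, ℝ) := ⟨fun x => ℓ (ψ x), by fun_prop⟩
  have hφf := apply_comp_of_section hL hLc hφ hφc hφψ hψ ℓ (f := f) fun _ => rfl
  exact hℓ.ne (by rw [← hφf, hyz, hφf])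

end AffineSection

end probMeasures

theorem IsProximallyIrreducibleExtension.exists_section {G : Type u} [Group G] [TopologicalSpace G]
    {X : Type v} [TopologicalSpace X] [CompactSpace X] [T2Space X] [MulAction G X]
    [ContinuousSMul G X] (hX : IsUniversalMinimalProximalFlow.{u, v, w} G X) {E : Type w}
    [AddCommGroup E] [Module ℝ E] [TopologicalSpace E] [IsTopologicalAddGroup E]
    [ContinuousSMul ℝ E] [LocallyConvexSpace ℝ E] [T2Space E] {L : Set E} [MulAction G L]
    (hL : IsAffineFlow G L) {φ : L → probMeasures X}
    (hφ : IsProximallyIrreducibleExtension G φ) :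
    ∃ ψ : X → L, Continuous ψ ∧ range ψ = extremeBoundary L ∧
      φ ∘ ψ = probMeasures.dirac := by
  have : Nonempty X := hX.minimal.nonempty
  have : CompactSpace L := isCompact_iff_compactSpace.1 hL.isCompact
  have := hL.continuousSMul
  have hK := probMeasures.isAffineFlow X G
  have hKmin := probMeasures.minimal_extremeBoundary hX.minimal
  have hmaps := hφ.mapsTo_extremeBoundary hL hK hKmin
  obtain ⟨ψ, hψ, hψs, hrange⟩ := hX.exists_range_eq (hφ.minimal_extremeBoundary hL hK hKmin)
    fun x hx y hy => hφ.isProximalPair_of_map hL hK hKmin hx hy <|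
      probMeasures.isProximalPair_of_mem_extremeBoundary hX.proximal (hmaps hx) (hmaps hy)
  refine ⟨ψ, hψ, hrange, ?_⟩
  obtain ⟨x⟩ := hX.minimal.nonempty
  obtain ⟨y, hxy⟩ : φ (ψ x) ∈ range probMeasures.dirac := by
    rw [← probMeasures.extremeBoundary_eq_range_dirac]
    exact hmaps (hrange ▸ mem_range_self x)
  exact hX.minimal.eq_of_isProximalFlow hX.proximal (hφ.continuous.comp hψ)
    probMeasures.continuous_dirac (fun g z => by simp only [Function.comp_apply, hψs, hφ.map_smul])
    probMeasures.dirac_smul hxy.symm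

theorem mainTheorem11_general {G : Type u} [Group G] [TopologicalSpace G] {X : Type v}
    [TopologicalSpace X] [CompactSpace X] [T2Space X] [MulAction G X] [ContinuousSMul G X]
    (hX : IsUniversalMinimalProximalFlow.{u, v, w} G X) :
    IsProximallyIrreducibleFlow.{u, v, w} G (probMeasures X) := by
  have : Nonempty X := hX.minimal.nonempty
  refine ⟨probMeasures.isAffineFlow X G, fun E _ _ _ _ _ _ _ L _ hL φ hφ => ?_⟩
  have : CompactSpace L := isCompact_iff_compactSpace.1 hL.isCompact
  obtain ⟨ψ, hψ, hrange, hφψ⟩ := hφ.exists_section hX hL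
  have hgen : closedConvexHull ℝ (Subtype.val '' range ψ) = L :=
    hrange ▸ closedConvexHull_image_extremeBoundary hL.isCompact hL.convex
  have hinj : Function.Injective φ := probMeasures.injective_of_section hL.isCompact hL.convex
    hφ.affine hφ.continuous hψ (congrFun hφψ) hgen
  exact isHomeomorph_iff_continuous_bijective.2 ⟨hφ.continuous, hinj, hφ.surjective⟩

/-- For a Polish group `G`, the affine flow `P(Π(G))` of regular Borel probability measures on the
universal minimal proximal flow `Π(G)` is proximally irreducible. -/
theorem mainTheorem11 (G : Type u) [Group G] [TopologicalSpace G] [IsTopologicalGroup G]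
    [PolishSpace G] :
    IsProximallyIrreducibleFlow.{u, u, w} G (probMeasures (UMPF G)) :=
  mainTheorem11_general UMPF.isUniversal
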